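/- Let $K$ be a field and let $\mathbb{A}^{\to}_n$ be the linearly oriented quiver $1\to 2\to\cdots\to n$. All representations are over $K$, with a finite-dimensional vector space at each vertex. A representation is indecomposable if it is nonzero and is not the direct sum of two proper subrepresentations. A morphism $f\colon M\to N$ of representations is irreducible if it is neither a section nor a retraction and, for every factorization $f=f_1f_2$ with $f_2\colon M\to W$ and $f_1\colon W\to N$, either $f_1$ is a retraction or $f_2$ is a section. The Auslander--Reiten quiver $\Gamma=(\Gamma_0,\Gamma_1)$ of $\mathbb{A}^{\to}_n$ has as vertices the isomorphism classes of indecomposable representations, with one arrow $[M]\to[N]$ if there exists an irreducible morphism $M\to N$, and no arrow otherwise. For $1\le b\le d\le n$ let $\mathbb{I}[b,d]$ be the interval representation, with $\mathbb{I}[b,d]_i=K$ for $b\le i\le d$, $\mathbb{I}[b,d]_i=0$ otherwise, and the identity map for each arrow $K\to K$. Then the representations $\mathbb{I}[b,d]$ are indecomposable and $(b,d)\mapsto[\mathbb{I}[b,d]]$ is a bijection from the grid $\{(b,d)\in\mathbb{N}^2\mid 1\le b\le d\le n\}$ of persistence diagrams onto $\Gamma_0$. The arrows of $\Gamma$ are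 exactly $$[\mathbb{I}[b,d]]\to[\mathbb{I}[b-1,d]]\quad(1<b\le d\le n)\qquad\text{and}\qquad [\mathbb{I}[b,d]]\to[\mathbb{I}[b,d-1]]\quad(1\le b<d\le n).$$ -/

import Mathlib

open CategoryTheory

universe w v u

/-- A finite dimensional representation over `K` of a quiver `Q`: a finite dimensional vector
space at every vertex and a linear map for every arrow. -/
structure QuiverRep (K : Type u) [Field K] (Q : Type w) [Quiver.{v} Q] where
  /-- the vector space at a vertex -/
  space : Q → Type u
  [addCommGroup : ∀ a, AddCommGroup (space a)]
  [module : ∀ a, Module K (space a)]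
  [finiteDimensional : ∀ a, FiniteDimensional K (space a)]
  /-- the linear map of an arrow -/
  map : ∀ {a b : Q}, (a ⟶ b) → (space a →ₗ[K] space b)

namespace QuiverRep

attribute [instance] QuiverRep.addCommGroup QuiverRep.module QuiverRep.finiteDimensional

variable {K : Type u} [Field K] {Q : Type w} [Quiver.{v} Q]

/-- A morphism of representations: linear maps at the vertices that commute with the maps of
the arrows. -/
@[ext]
structure Hom (M N : QuiverRep K Q) where
  /-- the component at a vertex -/
  app : ∀ a : Q, M.space a →ₗ[K] N.space a
  comm : ∀ {a b : Q} (α : a ⟶ b), N.map α ∘ₗ app a = app b ∘ₗ M.map α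

/-- The category of finite dimensional representations of `Q` over `K`. -/
instance category : Category (QuiverRep K Q) where
  Hom M N := Hom M N
  id M := ⟨fun _ => LinearMap.id, fun _ => rfl⟩
  comp {L M N} f g := ⟨fun a => g.app a ∘ₗ f.app a, fun {a b} α => by
    rw [← LinearMap.comp_assoc, g.comm α, LinearMap.comp_assoc, f.comm α,
      LinearMap.comp_assoc]⟩

/-- A subrepresentation: subspaces at the vertices, closed under the maps of the arrows. -/
structure Subrep (M : QuiverRep K Q) where
  /-- the subspace at a vertex -/
  carrier : ∀ a : Q, Submodule K (M.space a)
  map_mem : ∀ {a b : Q} (α : a ⟶ b) (x : M.space a), x ∈ carrier a → M.map α x ∈ carrier b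

/-- A subrepresentation of `M` is proper if it is not all of `M`. -/
def Subrep.IsProper {M : QuiverRep K Q} (N : M.Subrep) : Prop :=
  ∃ a : Q, N.carrier a ≠ ⊤

/-- `M` is the (internal) direct sum of its subrepresentations `N` and `N'`. -/
def Subrep.IsDirectSum {M : QuiverRep K Q} (N N' : M.Subrep) : Prop :=
  ∀ a : Q, IsCompl (N.carrier a) (N'.carrier a)

/-- `M` is indecomposable: it is nonzero and not a direct sum of two proper
subrepresentations. -/
def IsIndecomposable (M : QuiverRep K Q) : Prop :=
  (∃ a : Q, Nontrivial (M.space a)) ∧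
    ¬ ∃ N N' : M.Subrep, N.IsProper ∧ N'.IsProper ∧ N.IsDirectSum N'

/-- A morphism `f` is irreducible if it is neither a section (`IsSplitMono`) nor a retraction
(`IsSplitEpi`), and in every factorization `f = f₁ ∘ f₂` the morphism `f₁` is a retraction or
`f₂` is a section. -/
def IsIrreducible {M N : QuiverRep K Q} (f : M ⟶ N) : Prop :=
  (¬ IsSplitMono f ∧ ¬ IsSplitEpi f) ∧
    ∀ (W : QuiverRep K Q) (f₂ : M ⟶ W) (f₁ : W ⟶ N), f = f₂ ≫ f₁ → IsSplitEpi f₁ ∨ IsSplitMono f₂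

/-- Isomorphism classes of representations. -/
abbrev IsoClass (K : Type u) [Field K] (Q : Type w) [Quiver.{v} Q] :=
  Quotient (isIsomorphicSetoid (QuiverRep K Q))

/-- The isomorphism class of a representation. -/
def isoClass (M : QuiverRep K Q) : IsoClass K Q := Quotient.mk _ M

end QuiverRep

/-- The vertices of the Auslander–Reiten quiver of the path algebra `KQ`: the isomorphism
classes of indecomposable representations. -/
def ARQuiver (K : Type u) [Field K] (Q : Type w) [Quiver.{v} Q] :=
  {c : QuiverRep.IsoClass K Q // ∃ M : QuiverRep K Q, M.isoClass = c ∧ M.IsIndecomposable}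

/-- The Auslander–Reiten quiver: there is one arrow `[M] ⟶ [N]` if an irreducible
morphism `M ⟶ N` exists, and none otherwise. -/
instance ARQuiver.quiver (K : Type u) [Field K] (Q : Type w) [Quiver.{v} Q] : Quiver (ARQuiver K Q) where
  Hom x y := PLift (∃ (M N : QuiverRep K Q) (f : M ⟶ N),
    M.isoClass = x.1 ∧ N.isoClass = y.1 ∧ QuiverRep.IsIrreducible f)

/-- The vertices `1, …, n` of the linearly oriented quiver of type `A_n`. -/
def LinearA (n : ℕ) : Type := {i : ℕ // 1 ≤ i ∧ i ≤ n}

/-- The linearly oriented quiver `1 ⟶ 2 ⟶ ⋯ ⟶ n`: one arrow `i ⟶ i + 1` for `1 ≤ i < n`. -/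
instance LinearA.quiver (n : ℕ) : Quiver (LinearA n) where
  Hom i j := PLift (i.1 + 1 = j.1)

/-- The space of the interval representation `I[b,d]` at the vertex `i`: it is `K`
for `b ≤ i ≤ d` and `0` otherwise. -/
noncomputable def intervalSpace (K : Type u) [Field K] (b d i : ℕ) : Submodule K K :=
  if b ≤ i ∧ i ≤ d then ⊤ else ⊥

/-- The map of `I[b,d]` from the vertex `i` to the vertex `j`: the identity of `K` if both spaces
are `K`, and zero otherwise. -/
noncomputable def intervalMap (K : Type u) [Field K] (b d i j : ℕ) :
    intervalSpace K b d i →ₗ[K] intervalSpace K b d j :=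
  if h : (b ≤ i ∧ i ≤ d) ∧ (b ≤ j ∧ j ≤ d) then
    Submodule.inclusion (le_top.trans_eq (if_pos h.2).symm)
  else 0

/-- The interval representation `I[b,d]` of the linearly oriented quiver of type `A_n`. -/
noncomputable def intervalRep (K : Type u) [Field K] (n b d : ℕ) :
    QuiverRep K (LinearA n) where
  space i := intervalSpace K b d i.1
  map {i j} _ := intervalMap K b d i.1 j.1

/-- The grid points `{(b,d) ∈ ℕ² | 1 ≤ b ≤ d ≤ n}` of persistence diagrams. -/
def PDGrid (n : ℕ) : Type := {p : ℕ × ℕ // 1 ≤ p.1 ∧ p.1 ≤ p.2 ∧ p.2 ≤ n}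

/-! A morphism `I[b,d] ⟶ M` amounts to a vector of `M` at `b` that dies beyond `d` (`fromVec`), and
a morphism `M ⟶ I[b,d]` to a functional on `M` at `d` that kills all that comes from before `b`
(`toFunctional`). The composite `I[b,d] ⟶ M ⟶ I[b,d]` is multiplication by the value of the
functional on the vector transported to `d`, so splitting is a question of linear algebra.

Vertices: if `b` is the first vertex of the support of `M` and `d` the last one that some vector at
`b` reaches, these data split off `I[b,d]` (`exists_interval_summand`). An indecomposable `M` is
therefore an interval, and the end points are isomorphism invariants (`eq_of_comp_eq_id`).

Arrows: let the inclusion or projection from `I[b,d]` factor through `W`, and let `v` be the image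
at `d` of the generator. Either a functional detects `v` and the first factor is a section, or `v`
is zero or comes from `b - 1`, which yields a vector splitting the second factor
(`exists_transition_or_functional`). Conversely, a nonzero morphism `I[b,d] ⟶ I[b',d']` requires `b'
≤ b ≤ d' ≤ d` and factors through every interval in between, so irreducibility leaves room for one
step only (`eq_of_isIrreducible`). -/

section LinearA

variable {n : ℕ}

/-- Induction along the arrows of the linear quiver, starting at a vertex `i`. -/
theorem LinearA.le_induction {i : LinearA n} {P : LinearA n → Prop} (base : P i)
    (step : ∀ (j k : LinearA n), (j ⟶ k) → i.1 ≤ j.1 → P j → P k) :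
    ∀ j : LinearA n, i.1 ≤ j.1 → P j := by
  rintro ⟨j, hj⟩ hij
  change i.1 ≤ j at hij
  induction j, hij using Nat.le_induction with
  | base => exact base
  | succ j hij ih =>
    have hj' : 1 ≤ j ∧ j ≤ n := ⟨i.2.1.trans hij, by omega⟩
    exact step ⟨j, hj'⟩ ⟨j + 1, hj⟩ (PLift.up rfl) hij (ih hj')

theorem LinearA.ext {i j : LinearA n} (h : i.1 = j.1) : i = j := Subtype.ext h

theorem LinearA.hom_eq {i j : LinearA n} (α : i ⟶ j) : i.1 + 1 = j.1 := α.down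

/-- The vertex with number `k`, if there is a vertex with number `k + 1`. -/
def LinearA.pred {j : LinearA n} (k : ℕ) (hk : 1 ≤ k) (hj : j.1 = k + 1) : LinearA n :=
  ⟨k, hk, by have := j.2.2; omega⟩

/-- The arrow from the vertex with number `k` to the vertex with number `k + 1`. -/
def LinearA.predHom {j : LinearA n} (k : ℕ) (hk : 1 ≤ k) (hj : j.1 = k + 1) :
    LinearA.pred k hk hj ⟶ j :=
  PLift.up hj.symm

end LinearA

namespace QuiverRep

/-! ### Direct summands and isomorphism invariance -/

section General

variable {K : Type u} [Field K] {Q : Type w} [Quiver.{v} Q] {L M N : QuiverRep K Q}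

@[simp]
theorem id_app (a : Q) : Hom.app (𝟙 M) a = LinearMap.id := rfl

@[simp]
theorem comp_app (f : L ⟶ M) (g : M ⟶ N) (a : Q) :
    Hom.app (f ≫ g) a = Hom.app g a ∘ₗ Hom.app f a := rfl

theorem hom_ext {f g : M ⟶ N} (h : ∀ a x, Hom.app f a x = Hom.app g a x) : f = g :=
  Hom.ext (funext fun a => LinearMap.ext (h a))

theorem comm_apply (f : M ⟶ N) {a b : Q} (α : a ⟶ b) (x : M.space a) :
    N.map α (Hom.app f a x) = Hom.app f b (M.map α x) :=
  LinearMap.congr_fun (Hom.comm f α) x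

theorem app_section_apply {f : M ⟶ N} {g : N ⟶ M} (h : f ≫ g = 𝟙 M) (a : Q) (x : M.space a) :
    Hom.app g a (Hom.app f a x) = x := by
  have := congrArg (fun k : M ⟶ M => Hom.app k a x) h
  exact this

/-- The image of a morphism. -/
def rangeSubrep (f : M ⟶ N) : N.Subrep where
  carrier a := LinearMap.range (Hom.app f a)
  map_mem := by
    rintro a b α _ ⟨x, rfl⟩
    exact ⟨M.map α x, (comm_apply f α x).symm⟩

/-- The kernel of a morphism. -/
def kerSubrep (f : M ⟶ N) : M.Subrep where
  carrier a := LinearMap.ker (Hom.app f a)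
  map_mem := by
    intro a b α x hx
    rw [LinearMap.mem_ker] at hx ⊢
    rw [← comm_apply, hx, map_zero]

/-- A nonzero direct summand of an indecomposable representation is the whole representation. -/
theorem IsIndecomposable.nonempty_iso (hM : M.IsIndecomposable) {f : N ⟶ M} {g : M ⟶ N}
    (h : f ≫ g = 𝟙 N) (hN : ∃ a, Nontrivial (N.space a)) : Nonempty (N ≅ M) := by
  have hsum : (rangeSubrep f).IsDirectSum (kerSubrep g) := by
    intro a
    constructor
    · rw [Submodule.disjoint_def]
      rintro _ ⟨x, rfl⟩ hx
      have hx' : Hom.app g a (Hom.app f a x) = 0 := hx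
      rw [app_section_apply h] at hx'
      rw [hx', map_zero]
    · rw [codisjoint_iff, eq_top_iff]
      intro x _
      refine Submodule.mem_sup.2 ⟨_, ⟨Hom.app g a x, rfl⟩, x - Hom.app f a (Hom.app g a x), ?_, ?_⟩
      · change Hom.app g a _ = 0
        rw [map_sub, app_section_apply h, sub_self]
      · exact add_sub_cancel _ _
  have hker : (kerSubrep g).IsProper := by
    obtain ⟨a, ha⟩ := hN
    obtain ⟨x, hx⟩ := exists_ne (0 : N.space a)
    refine ⟨a, fun htop => hx ?_⟩
    have : Hom.app f a x ∈ (kerSubrep g).carrier a := htop ▸ Submodule.mem_top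
    rw [← app_section_apply h a x]
    exact this
  have hrange : ¬ (rangeSubrep f).IsProper := fun hp => hM.2 ⟨_, _, hp, hker, hsum⟩
  refine ⟨⟨f, g, h, hom_ext fun a x => ?_⟩⟩
  have hx : x ∈ (rangeSubrep f).carrier a := by
    rw [show (rangeSubrep f).carrier a = ⊤ from not_not.1 fun hne => hrange ⟨a, hne⟩]
    exact Submodule.mem_top
  obtain ⟨y, rfl⟩ := hx
  change Hom.app f a (Hom.app g a (Hom.app f a y)) = Hom.app f a y
  rw [app_section_apply h]

/-- Irreducibility is invariant under isomorphisms of the source and the target. -/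
theorem IsIrreducible.iso_comp_iso {M' N' : QuiverRep K Q} {f : M ⟶ N} (hf : IsIrreducible f)
    (s : M' ≅ M) (t : N ≅ N') : IsIrreducible (s.hom ≫ f ≫ t.hom) := by
  refine ⟨⟨fun h => hf.1.1 ?_, fun h => hf.1.2 ?_⟩, fun W f₂ f₁ h => ?_⟩
  · obtain ⟨⟨r, hr⟩⟩ := h
    refine ⟨⟨t.hom ≫ r ≫ s.hom, ?_⟩⟩
    rw [← cancel_epi s.hom]
    simpa using congrArg (· ≫ s.hom) hr
  · obtain ⟨⟨r, hr⟩⟩ := h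
    refine ⟨⟨t.hom ≫ r ≫ s.hom, ?_⟩⟩
    rw [← cancel_mono t.hom]
    simpa using congrArg (t.hom ≫ ·) hr
  · rcases hf.2 W (s.inv ≫ f₂) (f₁ ≫ t.inv) (by simp [← reassoc_of% h]) with ⟨⟨r, hr⟩⟩ | ⟨⟨r, hr⟩⟩
    · refine Or.inl ⟨⟨t.inv ≫ r, ?_⟩⟩
      rw [← cancel_mono t.inv, Category.assoc, Category.assoc, hr]
      simp
    · refine Or.inr ⟨⟨r ≫ s.inv, ?_⟩⟩
      rw [← cancel_epi s.inv, ← Category.assoc, ← Category.assoc, hr]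
      simp

theorem isoClass_eq_iff : M.isoClass = N.isoClass ↔ Nonempty (M ≅ N) :=
  Quotient.eq (r := isIsomorphicSetoid (QuiverRep K Q))

end General

/-! ### Composite maps along paths -/

section Transition

variable {K : Type u} [Field K] {n : ℕ} {M N : QuiverRep K (LinearA n)}

/-- The composite of the maps of `M` along the path from `i` to `j`, by recursion on the number
`k` of `j`; it is zero if there is no path. -/
def transitionAux (M : QuiverRep K (LinearA n)) (i : LinearA n) :
    ∀ (k : ℕ) (j : LinearA n), j.1 = k → (M.space i →ₗ[K] M.space j)
  -- No vertex has number 0, so this value is immaterial.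
  | 0, _, _ => 0
  | k + 1, j, hj =>
    if h : i.1 = j.1 then LinearA.ext h ▸ LinearMap.id
    else if h' : i.1 ≤ k then
      M.map (LinearA.predHom k (i.2.1.trans h') hj) ∘ₗ
        transitionAux M i k (LinearA.pred k (i.2.1.trans h') hj) rfl
    else 0

/-- The composite of the maps of `M` along the path from `i` to `j`, and zero if `j < i`. -/
def transition (M : QuiverRep K (LinearA n)) (i j : LinearA n) : M.space i →ₗ[K] M.space j :=
  transitionAux M i j.1 j rfl

theorem transitionAux_self (i : LinearA n) (k : ℕ) (hk : i.1 = k) :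
    M.transitionAux i k i hk = LinearMap.id := by
  cases k with
  | zero => exact absurd i.2.1 (by omega)
  | succ k =>
    rw [transitionAux, dif_pos rfl]

theorem transition_self (i : LinearA n) : M.transition i i = LinearMap.id :=
  transitionAux_self i i.1 rfl

theorem transitionAux_of_lt {i j : LinearA n} (h : j.1 < i.1) (k : ℕ) (hk : j.1 = k) :
    M.transitionAux i k j hk = 0 := by
  cases k with
  | zero => rfl
  | succ k => rw [transitionAux, dif_neg (by omega), dif_neg (by omega)]

theorem transition_of_lt {i j : LinearA n} (h : j.1 < i.1) : M.transition i j = 0 :=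
  transitionAux_of_lt h j.1 rfl

theorem map_transitionAux {i j k : LinearA n} (h : i.1 ≤ j.1) (α : j ⟶ k) (l : ℕ)
    (hl : k.1 = l) : M.map α ∘ₗ M.transition i j = M.transitionAux i l k hl := by
  have hα := LinearA.hom_eq α
  cases l with
  | zero => exact absurd k.2.1 (by omega)
  | succ l =>
    rw [transitionAux, dif_neg (by omega), dif_pos (by omega)]
    obtain rfl : j.1 = l := by omega
    rfl

theorem map_transition {i j k : LinearA n} (h : i.1 ≤ j.1) (α : j ⟶ k) (x : M.space i) :
    M.map α (M.transition i j x) = M.transition i k x :=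
  LinearMap.congr_fun (map_transitionAux h α k.1 rfl) x

theorem map_eq_transition {i j : LinearA n} (α : i ⟶ j) (x : M.space i) :
    M.map α x = M.transition i j x := by
  rw [← map_transition le_rfl α, transition_self, LinearMap.id_apply]

theorem transition_transition {i j k : LinearA n} (hij : i.1 ≤ j.1) (hjk : j.1 ≤ k.1)
    (x : M.space i) : M.transition j k (M.transition i j x) = M.transition i k x := by
  refine LinearA.le_induction (i := j)
    (P := fun k => M.transition j k (M.transition i j x) = M.transition i k x) ?_ ?_ k hjk
  · rw [transition_self, LinearMap.id_apply]
  · intro k l α hk ih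
    rw [← map_transition hk α, ih, map_transition (hij.trans hk) α]

theorem transition_map {i j k : LinearA n} (α : i ⟶ j) (h : j.1 ≤ k.1) (x : M.space i) :
    M.transition j k (M.map α x) = M.transition i k x := by
  rw [map_eq_transition, transition_transition (by have := LinearA.hom_eq α; omega) h]

/-- Naturality passes from arrows to paths by induction; for `j < i` both sides vanish by the
convention for `transition`. -/
theorem app_transition (f : M ⟶ N) (i j : LinearA n) (x : M.space i) :
    Hom.app f j (M.transition i j x) = N.transition i j (Hom.app f i x) := by
  rcases lt_or_ge j.1 i.1 with h | h
  · rw [transition_of_lt h, transition_of_lt h, LinearMap.zero_apply, LinearMap.zero_apply,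
      map_zero]
  · refine LinearA.le_induction (i := i)
      (P := fun j => Hom.app f j (M.transition i j x) = N.transition i j (Hom.app f i x)) ?_ ?_ j h
    · rw [transition_self, transition_self, LinearMap.id_apply, LinearMap.id_apply]
    · intro j k α hj ih
      rw [← map_transition hj α, ← map_transition hj α, ← ih, comm_apply]

/-- A vector `v` at `d` either comes from a vertex `i < b` (or vanishes), or it is detected by a
functional that kills everything coming from the vertices `i < b`. -/
theorem exists_transition_or_functional {b d : LinearA n} (hbd : b.1 ≤ d.1) (v : M.space d) :
    (v = 0 ∨ ∃ i : LinearA n, i.1 + 1 = b.1 ∧ ∃ z, M.transition i d z = v) ∨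
      ∃ ψ : M.space d →ₗ[K] K, ψ v = 1 ∧ ∀ i : LinearA n, i.1 < b.1 →
        ∀ z, ψ (M.transition i d z) = 0 := by
  have key : ∀ S : Submodule K (M.space d), v ∉ S →
      ∃ ψ : M.space d →ₗ[K] K, ψ v = 1 ∧ ∀ z ∈ S, ψ z = 0 := by
    intro S hv
    obtain ⟨ψ, hψ, hS⟩ := S.exists_le_ker_of_notMem hv
    refine ⟨(ψ v)⁻¹ • ψ, ?_, fun z hz => ?_⟩
    · rw [LinearMap.smul_apply, smul_eq_mul, inv_mul_cancel₀ hψ]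
    · rw [LinearMap.smul_apply, LinearMap.mem_ker.1 (hS hz), smul_zero]
  by_cases hb : b.1 = 1
  · by_cases hv : v = 0
    · exact Or.inl (Or.inl hv)
    · obtain ⟨ψ, hψ, -⟩ := key ⊥ (by simpa using hv)
      exact Or.inr ⟨ψ, hψ, fun i hi => absurd i.2.1 (by omega)⟩
  -- Every path from before `b` to `d` passes through `b - 1`, so the image from this single vertex
  -- contains all the others.
  · let i : LinearA n := ⟨b.1 - 1, by have := b.2; omega⟩
    have hi : i.1 + 1 = b.1 := by
      have := b.2
      change b.1 - 1 + 1 = b.1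
      omega
    by_cases hv : v ∈ LinearMap.range (M.transition i d)
    · exact Or.inl (Or.inr ⟨i, hi, hv⟩)
    · obtain ⟨ψ, hψ, hS⟩ := key _ hv
      refine Or.inr ⟨ψ, hψ, fun j hj z => hS _ ⟨M.transition j i z, ?_⟩⟩
      exact transition_transition (by omega) (by omega) z

end Transition

/-! ### Morphisms from and to interval representations -/

section Interval

variable {K : Type u} [Field K] {n : ℕ} {M : QuiverRep K (LinearA n)}

theorem mem_intervalSpace {b d i : ℕ} {c : K} :
    c ∈ intervalSpace K b d i ↔ (b ≤ i ∧ i ≤ d) ∨ c = 0 := by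
  unfold intervalSpace
  split_ifs with h <;> simp [h]

theorem intervalSpace_eq_zero {b d i : ℕ} (h : ¬ (b ≤ i ∧ i ≤ d)) (c : intervalSpace K b d i) :
    c = 0 :=
  Subtype.ext ((mem_intervalSpace.1 c.2).resolve_left h)

theorem coe_intervalMap {b d i j : ℕ} (hi : b ≤ i ∧ i ≤ d) (hj : b ≤ j ∧ j ≤ d)
    (c : intervalSpace K b d i) : (intervalMap K b d i j c : K) = c := by
  unfold intervalMap
  rw [dif_pos ⟨hi, hj⟩]
  rfl

/-- The element of `K` underlying a vector of an interval representation. -/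
noncomputable def coeff {b d : ℕ} {i : LinearA n} (x : (intervalRep K n b d).space i) : K :=
  Subtype.val (p := (· ∈ intervalSpace K b d i.1)) x

/-- The vector of an interval representation with a given underlying element of `K`. -/
noncomputable def intervalVec (b d : ℕ) (i : LinearA n) (h : b ≤ i.1 ∧ i.1 ≤ d) (c : K) :
    (intervalRep K n b d).space i :=
  (⟨c, mem_intervalSpace.2 (Or.inl h)⟩ : intervalSpace K b d i.1)

@[simp]
theorem coeff_intervalVec (b d : ℕ) (i : LinearA n) (h : b ≤ i.1 ∧ i.1 ≤ d) (c : K) :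
    coeff (intervalVec b d i h c) = c := rfl

theorem coeff_injective {b d : ℕ} {i : LinearA n} {x y : (intervalRep K n b d).space i}
    (h : coeff x = coeff y) : x = y :=
  Subtype.ext h

@[simp]
theorem coeff_smul {b d : ℕ} {i : LinearA n} (c : K) (x : (intervalRep K n b d).space i) :
    coeff (c • x) = c * coeff x := rfl

@[simp]
theorem coeff_zero {b d : ℕ} {i : LinearA n} :
    coeff (0 : (intervalRep K n b d).space i) = 0 := rfl

/-- The underlying element of `K`, as a linear map. -/
noncomputable def coeffLinear (K : Type u) [Field K] {n : ℕ} (b d : ℕ) (i : LinearA n) :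
    (intervalRep K n b d).space i →ₗ[K] K :=
  (intervalSpace K b d i.1).subtype

theorem coeffLinear_apply {b d : ℕ} {i : LinearA n} (x : (intervalRep K n b d).space i) :
    coeffLinear K b d i x = coeff x := rfl

theorem interval_eq_zero {b d : ℕ} {i : LinearA n} (h : ¬ (b ≤ i.1 ∧ i.1 ≤ d))
    (x : (intervalRep K n b d).space i) : x = 0 :=
  intervalSpace_eq_zero h x

theorem coeff_map {b d : ℕ} {i j : LinearA n} (α : i ⟶ j) (hi : b ≤ i.1 ∧ i.1 ≤ d)
    (hj : b ≤ j.1 ∧ j.1 ≤ d) (x : (intervalRep K n b d).space i) :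
    coeff ((intervalRep K n b d).map α x) = coeff x :=
  coe_intervalMap hi hj x

theorem coeff_transition {b d : ℕ} {i j : LinearA n} (hij : i.1 ≤ j.1) (hi : b ≤ i.1)
    (hj : j.1 ≤ d) (x : (intervalRep K n b d).space i) :
    coeff ((intervalRep K n b d).transition i j x) = coeff x := by
  refine LinearA.le_induction (i := i) (P := fun j => j.1 ≤ d →
    coeff ((intervalRep K n b d).transition i j x) = coeff x) ?_ ?_ j hij hj
  · intro _
    rw [transition_self, LinearMap.id_apply]
  · intro j k α hj ih hk
    have := LinearA.hom_eq α
    rw [← map_transition hj α, coeff_map α ⟨by omega, by omega⟩ ⟨by omega, hk⟩, ih (by omega)]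

/-- Outside of its support an interval representation vanishes, inside of it every vector is a
multiple of a transition of a generator. -/
theorem interval_eq_smul {b d : LinearA n} (hbd : b.1 ≤ d.1) {i : LinearA n}
    (x : (intervalRep K n b.1 d.1).space i) :
    x = coeff x • (intervalRep K n b.1 d.1).transition b i
      (intervalVec b.1 d.1 b ⟨le_rfl, hbd⟩ 1) := by
  by_cases h : b.1 ≤ i.1 ∧ i.1 ≤ d.1
  · refine coeff_injective ?_
    rw [coeff_smul, coeff_transition h.1 le_rfl h.2, coeff_intervalVec, mul_one]
  · rw [interval_eq_zero h x, coeff_zero, zero_smul]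

/-- A morphism from an interval representation is determined by the image of the generator. -/
theorem interval_hom_ext {b d : LinearA n} (hbd : b.1 ≤ d.1)
    {f g : intervalRep K n b.1 d.1 ⟶ M}
    (h : Hom.app f b (intervalVec b.1 d.1 b ⟨le_rfl, hbd⟩ 1) =
      Hom.app g b (intervalVec b.1 d.1 b ⟨le_rfl, hbd⟩ 1)) : f = g := by
  refine hom_ext fun i x => ?_
  rw [interval_eq_smul hbd x, map_smul, map_smul, app_transition, app_transition, h]

/-- The morphism from `I[b,d]` that maps the generator to a vector `x` at `b` which vanishes
beyond `d`. -/
noncomputable def fromVec (b d : LinearA n) (x : M.space b)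
    (hx : ∀ j : LinearA n, d.1 < j.1 → M.transition b j x = 0) :
    intervalRep K n b.1 d.1 ⟶ M where
  app i := (coeffLinear K b.1 d.1 i).smulRight (M.transition b i x)
  comm {i j} α := by
    ext y
    have hα := LinearA.hom_eq α
    change M.map α (coeff y • M.transition b i x) =
      coeff ((intervalRep K n b.1 d.1).map α y) • M.transition b j x
    by_cases hi : b.1 ≤ i.1 ∧ i.1 ≤ d.1
    · rw [map_smul, map_transition hi.1 α]
      by_cases hj : j.1 ≤ d.1
      · rw [coeff_map α hi ⟨by omega, hj⟩]
      · rw [hx j (by omega), smul_zero, smul_zero]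
    · rw [interval_eq_zero hi y, map_zero, coeff_zero, coeff_zero, zero_smul, zero_smul, map_zero]

theorem fromVec_app (b d : LinearA n) (x : M.space b)
    (hx : ∀ j : LinearA n, d.1 < j.1 → M.transition b j x = 0) (hbd : b.1 ≤ d.1) (c : K) :
    Hom.app (fromVec b d x hx) b (intervalVec b.1 d.1 b ⟨le_rfl, hbd⟩ c) = c • x := by
  change c • M.transition b b x = _
  rw [transition_self, LinearMap.id_apply]

/-- The morphism to `I[b,d]` given by a functional at `d` which kills everything that comes from
the vertices before `b`. -/
noncomputable def toFunctional (b d : LinearA n) (φ : M.space d →ₗ[K] K)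
    (hφ : ∀ i : LinearA n, i.1 < b.1 → ∀ z, φ (M.transition i d z) = 0) :
    M ⟶ intervalRep K n b.1 d.1 where
  app i := LinearMap.codRestrict (intervalSpace K b.1 d.1 i.1) (φ ∘ₗ M.transition i d) fun z => by
    rw [mem_intervalSpace, LinearMap.comp_apply]
    by_cases hb : b.1 ≤ i.1
    · by_cases hd : i.1 ≤ d.1
      · exact Or.inl ⟨hb, hd⟩
      · right
        rw [transition_of_lt (not_le.1 hd), LinearMap.zero_apply, map_zero]
    · exact Or.inr (hφ i (not_le.1 hb) z)
  comm {i j} α := by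
    ext z
    have hα := LinearA.hom_eq α
    refine coeff_injective ?_
    by_cases hj : b.1 ≤ j.1 ∧ j.1 ≤ d.1
    · by_cases hi : b.1 ≤ i.1
      · refine (coeff_map α ⟨hi, by omega⟩ hj _).trans ?_
        exact congrArg φ (transition_map α hj.2 z).symm
      -- The arrow enters the support at `b`: one side vanishes by `hφ`, the other because `I[b,d]`
      -- is zero at `i`.
      · have h₁ : φ (M.transition j d (M.map α z)) = 0 := by
          rw [transition_map α hj.2, hφ i (not_le.1 hi)]
        refine Eq.trans ?_ h₁.symm
        refine congrArg coeff ((congrArg ((intervalRep K n b.1 d.1).map α) ?_).trans (map_zero _))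
        exact interval_eq_zero (fun h => hi h.1) _
    · exact congrArg coeff ((interval_eq_zero hj _).trans (interval_eq_zero hj _).symm)

theorem coeff_toFunctional_app (b d : LinearA n) (φ : M.space d →ₗ[K] K)
    (hφ : ∀ i : LinearA n, i.1 < b.1 → ∀ z, φ (M.transition i d z) = 0) (i : LinearA n)
    (z : M.space i) :
    coeff (Hom.app (toFunctional b d φ hφ) i z) = φ (M.transition i d z) := rfl

/-- By naturality the vector can be transported inside `I[b,d]`, which is zero at `j`. This and the
next lemma show that the conditions in `fromVec` and `toFunctional` are necessary. -/
theorem transition_app_eq_zero {b d : LinearA n} (f : intervalRep K n b.1 d.1 ⟶ M)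
    (x : (intervalRep K n b.1 d.1).space b) {j : LinearA n} (hj : d.1 < j.1) :
    M.transition b j (Hom.app f b x) = 0 := by
  rw [← app_transition, interval_eq_zero (fun h => absurd h.2 (not_le.2 hj))
    (transition _ b j x), map_zero]

theorem app_transition_eq_zero {b d : LinearA n} (f : M ⟶ intervalRep K n b.1 d.1)
    {i : LinearA n} (hi : i.1 < b.1) (z : M.space i) :
    Hom.app f d (M.transition i d z) = 0 := by
  rw [app_transition, interval_eq_zero (fun h => absurd h.1 (not_le.2 hi)) (Hom.app f i z),
    map_zero]

/-- A morphism from `I[b,d]` is a section as soon as a functional detects the image of the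
generator at `d`. -/
theorem isSplitMono_of_functional {b d : LinearA n} (hbd : b.1 ≤ d.1)
    (f : intervalRep K n b.1 d.1 ⟶ M) (φ : M.space d →ₗ[K] K)
    (hφ : ∀ i : LinearA n, i.1 < b.1 → ∀ z, φ (M.transition i d z) = 0)
    (h : φ (M.transition b d (Hom.app f b (intervalVec b.1 d.1 b ⟨le_rfl, hbd⟩ 1))) = 1) :
    IsSplitMono f :=
  ⟨⟨toFunctional b d φ hφ, interval_hom_ext hbd (coeff_injective h)⟩⟩

/-- A morphism to `I[b,d]` is a retraction as soon as a vector at `b` which vanishes beyond `d`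
has a nontrivial image. -/
theorem isSplitEpi_of_vec {b d : LinearA n} (hbd : b.1 ≤ d.1)
    (f : M ⟶ intervalRep K n b.1 d.1) (y : M.space b)
    (hy : ∀ j : LinearA n, d.1 < j.1 → M.transition b j y = 0)
    (h : coeff (Hom.app f d (M.transition b d y)) = 1) : IsSplitEpi f := by
  refine ⟨⟨fromVec b d y hy, interval_hom_ext hbd (coeff_injective ?_)⟩⟩
  rw [comp_app, LinearMap.comp_apply, fromVec_app _ _ _ _ hbd, one_smul, id_app, LinearMap.id_apply,
    coeff_intervalVec, ← h, app_transition, coeff_transition hbd le_rfl le_rfl]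

theorem interval_nontrivial {b d : LinearA n} (hbd : b.1 ≤ d.1) :
    Nontrivial ((intervalRep K n b.1 d.1).space b) :=
  ⟨intervalVec b.1 d.1 b ⟨le_rfl, hbd⟩ 1, 0, fun h => one_ne_zero (congrArg coeff h)⟩

/-! ### Morphisms between two intervals -/

/-- Between interval representations there are only the obvious nonzero morphisms. -/
theorem le_of_app_ne_zero {b d b' d' : LinearA n} (hbd : b.1 ≤ d.1)
    (f : intervalRep K n b.1 d.1 ⟶ intervalRep K n b'.1 d'.1)
    (hf : Hom.app f b (intervalVec b.1 d.1 b ⟨le_rfl, hbd⟩ 1) ≠ 0) :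
    b'.1 ≤ b.1 ∧ b.1 ≤ d'.1 ∧ d'.1 ≤ d.1 := by
  have h : b'.1 ≤ b.1 ∧ b.1 ≤ d'.1 := by
    by_contra h
    exact hf (interval_eq_zero h _)
  refine ⟨h.1, h.2, ?_⟩
  by_contra hd
  refine hf (coeff_injective ?_)
  rw [← coeff_transition h.2 h.1 le_rfl, transition_app_eq_zero f _ (not_le.1 hd)]
  rfl

/-- Neither factor of a nonzero identity kills the generator of its source, so `le_of_app_ne_zero`
holds in both directions. -/
theorem eq_of_comp_eq_id {b d b' d' : LinearA n} (hbd : b.1 ≤ d.1) (hbd' : b'.1 ≤ d'.1)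
    (f : intervalRep K n b.1 d.1 ⟶ intervalRep K n b'.1 d'.1)
    (g : intervalRep K n b'.1 d'.1 ⟶ intervalRep K n b.1 d.1) (h : f ≫ g = 𝟙 _) :
    b.1 = b'.1 ∧ d.1 = d'.1 := by
  have key := app_section_apply h b (intervalVec b.1 d.1 b ⟨le_rfl, hbd⟩ 1)
  have hne : intervalVec (K := K) b.1 d.1 b ⟨le_rfl, hbd⟩ 1 ≠ 0 := fun h =>
    one_ne_zero (congrArg coeff h)
  have hf := le_of_app_ne_zero hbd f fun h₀ => hne (by rw [← key, h₀, map_zero])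
  have hg := le_of_app_ne_zero hbd' g fun h₀ => hne (by
    rw [← key, interval_eq_smul hbd' (Hom.app f b _), map_smul, app_transition, h₀, map_zero,
      smul_zero])
  omega

/-- The morphism `I[b,d] ⟶ I[b',d']` that is multiplication by `c` on the common support. -/
noncomputable def intervalHom (b d b' d' : LinearA n) (h : b'.1 ≤ b.1 ∧ b.1 ≤ d'.1 ∧ d'.1 ≤ d.1) (c : K) :
    intervalRep K n b.1 d.1 ⟶ intervalRep K n b'.1 d'.1 :=
  fromVec b d (intervalVec (K := K) b'.1 d'.1 b ⟨h.1, h.2.1⟩ c) fun j hj =>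
    interval_eq_zero (fun hj' => by omega) _

theorem coeff_intervalHom_app {b d b' d' : LinearA n}
    (h : b'.1 ≤ b.1 ∧ b.1 ≤ d'.1 ∧ d'.1 ≤ d.1) (c : K) {i : LinearA n} (hi : b.1 ≤ i.1)
    (hi' : i.1 ≤ d'.1) (x : (intervalRep K n b.1 d.1).space i) :
    coeff (Hom.app (intervalHom b d b' d' h c) i x) = coeff x * c := by
  change coeff (coeff x • (intervalRep K n b'.1 d'.1).transition b i
    (intervalVec b'.1 d'.1 b ⟨h.1, h.2.1⟩ c)) = _
  rw [coeff_smul, coeff_transition hi h.1 hi', coeff_intervalVec]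

/-! ### Indecomposability and interval summands -/

/-- Interval representations are indecomposable. -/
theorem interval_isIndecomposable {b d : LinearA n} (hbd : b.1 ≤ d.1) :
    (intervalRep K n b.1 d.1).IsIndecomposable := by
  refine ⟨⟨b, interval_nontrivial hbd⟩, ?_⟩
  -- A nonzero vector at `b` generates the whole interval. As the generator is a sum of vectors of
  -- the two summands, one summand contains such a vector.
  have key : ∀ S : (intervalRep K n b.1 d.1).Subrep, ∀ x ∈ S.carrier b, coeff x ≠ 0 →
      ¬ S.IsProper := by
    rintro S x hx hne ⟨a, ha⟩
    refine ha (eq_top_iff.2 fun y _ => ?_)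
    by_cases h : b.1 ≤ a.1 ∧ a.1 ≤ d.1
    · have hmem : (intervalRep K n b.1 d.1).transition b a x ∈ S.carrier a := by
        refine LinearA.le_induction (i := b)
          (P := fun a => (intervalRep K n b.1 d.1).transition b a x ∈ S.carrier a) ?_ ?_ a h.1
        · rwa [transition_self]
        · intro j k α hj ih
          rw [← map_transition hj α]
          exact S.map_mem α _ ih
      have : y = (coeff y / coeff x) • (intervalRep K n b.1 d.1).transition b a x := by
        refine coeff_injective ?_
        rw [coeff_smul, coeff_transition h.1 le_rfl h.2, div_mul_cancel₀ _ hne]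
      rw [this]
      exact Submodule.smul_mem _ _ hmem
    · rw [interval_eq_zero h y]
      exact Submodule.zero_mem _
  rintro ⟨S, T, hS, hT, hST⟩
  have htop : intervalVec (K := K) b.1 d.1 b ⟨le_rfl, hbd⟩ 1 ∈ S.carrier b ⊔ T.carrier b := by
    rw [(hST b).sup_eq_top]
    exact Submodule.mem_top
  obtain ⟨s, hs, t, ht, hst⟩ := Submodule.mem_sup.1 htop
  have hst' : coeff s + coeff t = 1 := congrArg coeff hst
  by_cases h : coeff s = 0
  · exact key T t ht (by rw [h, zero_add] at hst'; rw [hst']; exact one_ne_zero) hT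
  · exact key S s hs h hS

/-- A nonzero representation has an interval representation as a direct summand. -/
theorem exists_interval_summand (hM : ∃ a, Nontrivial (M.space a)) :
    ∃ b d : LinearA n, b.1 ≤ d.1 ∧
      ∃ (f : intervalRep K n b.1 d.1 ⟶ M) (g : M ⟶ intervalRep K n b.1 d.1), f ≫ g = 𝟙 _ := by
  obtain ⟨b, hb, hmin⟩ := (measure fun a : LinearA n => a.1).wf.has_min
    {a | Nontrivial (M.space a)} hM
  have hbb : M.transition b b ≠ 0 := by
    have : Nontrivial (M.space b) := hb
    obtain ⟨x, hx⟩ := exists_ne (0 : M.space b)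
    rw [transition_self]
    exact fun h => hx (LinearMap.congr_fun h x)
  -- Minimizing `n - a` picks the last vertex reached from `b`.
  obtain ⟨d, hd, hmax⟩ := (measure fun a : LinearA n => n - a.1).wf.has_min
    {a | M.transition b a ≠ 0} ⟨b, hbb⟩
  have hbd : b.1 ≤ d.1 := by
    by_contra h
    exact hd (transition_of_lt (not_le.1 h))
  obtain ⟨x, hx⟩ : ∃ x, M.transition b d x ≠ 0 := by
    by_contra! h
    exact hd (LinearMap.ext h)
  obtain ⟨φ, hφ⟩ : ∃ φ : M.space d →ₗ[K] K, φ (M.transition b d x) = 1 := by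
    obtain ⟨φ, hφ, -⟩ := (⊥ : Submodule K (M.space d)).exists_le_ker_of_notMem
      (by simpa using hx : M.transition b d x ∉ ⊥)
    exact ⟨(φ (M.transition b d x))⁻¹ • φ, by
      rw [LinearMap.smul_apply, smul_eq_mul, inv_mul_cancel₀ hφ]⟩
  have hx' : ∀ j : LinearA n, d.1 < j.1 → M.transition b j x = 0 := by
    intro j hj
    by_contra h
    refine hmax j (fun h₀ => h (by rw [h₀, LinearMap.zero_apply])) ?_
    have := j.2.2
    change n - j.1 < n - d.1
    omega
  have hφ' : ∀ i : LinearA n, i.1 < b.1 → ∀ z, φ (M.transition i d z) = 0 := by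
    intro i hi z
    have hz : z = 0 := by
      by_contra h
      exact hmin i ⟨z, 0, h⟩ hi
    rw [hz, map_zero, map_zero]
  refine ⟨b, d, hbd, fromVec b d x hx', toFunctional b d φ hφ', interval_hom_ext hbd ?_⟩
  refine coeff_injective ?_
  rw [comp_app, LinearMap.comp_apply, fromVec_app _ _ _ _ hbd, one_smul, coeff_toFunctional_app, hφ]
  rfl

/-! ### Irreducible morphisms between intervals -/

/-- The inclusion `I[b,d] ⟶ I[b-1,d]` is irreducible. -/
theorem isIrreducible_inclusion {b d b' : LinearA n} (hbd : b.1 ≤ d.1) (hb : b'.1 + 1 = b.1) :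
    IsIrreducible (intervalHom b d b' d ⟨by omega, hbd, le_rfl⟩ (1 : K)) := by
  refine ⟨⟨?_, ?_⟩, fun W f₂ f₁ h => ?_⟩
  · rintro ⟨⟨r, hr⟩⟩
    have := eq_of_comp_eq_id hbd (by omega) _ _ hr
    omega
  · rintro ⟨⟨r, hr⟩⟩
    have := eq_of_comp_eq_id (by omega) hbd _ _ hr
    omega
  · set e := intervalVec (K := K) b.1 d.1 b ⟨le_rfl, hbd⟩ 1
    have hone : coeff (Hom.app f₁ d (W.transition b d (Hom.app f₂ b e))) = 1 := by
      rw [← app_transition, ← LinearMap.comp_apply, ← comp_app, ← h,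
        coeff_intervalHom_app _ _ hbd le_rfl, coeff_transition hbd le_rfl le_rfl, mul_one]
      rfl
    rcases exists_transition_or_functional hbd (W.transition b d (Hom.app f₂ b e)) with
      (h₀ | ⟨i, hi, z, hz⟩) | ⟨ψ, hψ, hψ'⟩
    · rw [h₀, map_zero] at hone
      exact absurd hone zero_ne_one
    · obtain rfl : i = b' := LinearA.ext (by omega)
      -- Beyond `d` the vector `z` agrees with the image of the generator of `I[b,d]`, hence
      -- vanishes there.
      refine Or.inl (isSplitEpi_of_vec (by omega) f₁ z (fun j hj => ?_) (by rw [hz, hone]))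
      rw [← transition_transition (j := d) (by omega) hj.le, hz,
        transition_transition hbd hj.le, transition_app_eq_zero f₂ _ hj]
    · exact Or.inr (isSplitMono_of_functional hbd f₂ ψ hψ' hψ)

/-- The projection `I[b,d] ⟶ I[b,d-1]` is irreducible. -/
theorem isIrreducible_projection {b d d' : LinearA n} (hbd : b.1 ≤ d'.1) (hd : d'.1 + 1 = d.1) :
    IsIrreducible (intervalHom b d b d' ⟨le_rfl, hbd, by omega⟩ (1 : K)) := by
  have hbd' : b.1 ≤ d.1 := by omega
  refine ⟨⟨?_, ?_⟩, fun W f₂ f₁ h => ?_⟩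
  · rintro ⟨⟨r, hr⟩⟩
    have := eq_of_comp_eq_id hbd' hbd _ _ hr
    omega
  · rintro ⟨⟨r, hr⟩⟩
    have := eq_of_comp_eq_id hbd hbd' _ _ hr
    omega
  · set e := intervalVec (K := K) b.1 d.1 b ⟨le_rfl, hbd'⟩ 1
    have hone : coeff (Hom.app f₁ d' (W.transition b d' (Hom.app f₂ b e))) = 1 := by
      rw [← app_transition, ← LinearMap.comp_apply, ← comp_app, ← h,
        coeff_intervalHom_app _ _ hbd le_rfl, coeff_transition hbd le_rfl (by omega), mul_one]
      rfl
    have hvanish : ∀ y : W.space b, W.transition b d y = 0 →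
        ∀ j : LinearA n, d'.1 < j.1 → W.transition b j y = 0 := by
      intro y hy j hj
      rw [← transition_transition (j := d) hbd' (by omega), hy, map_zero]
    rcases exists_transition_or_functional hbd' (W.transition b d (Hom.app f₂ b e)) with
      (h₀ | ⟨i, hi, z, hz⟩) | ⟨ψ, hψ, hψ'⟩
    · exact Or.inl (isSplitEpi_of_vec hbd f₁ _ (hvanish _ h₀) hone)
    -- The correction by `z` makes the vector vanish at `d`, and `f₁` does not see it, since
    -- `I[b,d']` is zero at `i = b - 1`.
    · refine Or.inl (isSplitEpi_of_vec hbd f₁ (Hom.app f₂ b e - W.transition i b z)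
        (hvanish _ ?_) ?_)
      · rw [map_sub, transition_transition (by omega) hbd', hz, sub_self]
      · rw [map_sub, transition_transition (by omega) hbd, map_sub,
          app_transition_eq_zero f₁ (i := i) (by omega), sub_zero, hone]
    · exact Or.inr (isSplitMono_of_functional hbd' f₂ ψ hψ' hψ)

/-- An irreducible morphism between interval representations moves exactly one end point by one
step to the left. -/
theorem eq_of_isIrreducible {b d b' d' : LinearA n} (hbd : b.1 ≤ d.1) (hbd' : b'.1 ≤ d'.1)
    {f : intervalRep K n b.1 d.1 ⟶ intervalRep K n b'.1 d'.1} (hf : IsIrreducible f) :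
    (b'.1 + 1 = b.1 ∧ d'.1 = d.1) ∨ (b'.1 = b.1 ∧ d'.1 + 1 = d.1) := by
  set x := Hom.app f b (intervalVec b.1 d.1 b ⟨le_rfl, hbd⟩ 1) with hx
  -- A vanishing `f` would factor through the zero endomorphism of its target.
  have hne : x ≠ 0 := by
    intro h₀
    rcases hf.2 (intervalRep K n b'.1 d'.1) f (fromVec b' d' 0 fun _ _ => map_zero _)
      (interval_hom_ext hbd (by
        rw [comp_app, LinearMap.comp_apply, ← hx, h₀, map_zero])) with ⟨⟨r, hr⟩⟩ | h
    · have := app_section_apply hr b' (intervalVec b'.1 d'.1 b' ⟨le_rfl, hbd'⟩ 1)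
      have h₁ : ∀ y, Hom.app (fromVec b' d' (0 : (intervalRep K n b'.1 d'.1).space b')
          fun _ _ => map_zero _) b' y = 0 := by
        intro y
        rw [interval_eq_smul hbd' y, map_smul, transition_self, LinearMap.id_apply, fromVec_app _ _ _ _ hbd',
          smul_zero, smul_zero]
      rw [h₁] at this
      exact one_ne_zero (congrArg coeff this).symm
    · exact hf.1.1 h
  have hle := le_of_app_ne_zero hbd f hne
  -- Factor `f` through an interval one step away from its source.
  have factor : ∀ (c e : LinearA n), c.1 ≤ b.1 → b.1 ≤ e.1 → e.1 ≤ d.1 → b'.1 ≤ c.1 →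
      d'.1 ≤ e.1 → (c.1 ≠ b.1 ∨ e.1 ≠ d.1) → c.1 = b'.1 ∧ e.1 = d'.1 := by
    intro c e h₁ h₂ h₃ h₄ h₅ h₆
    rcases hf.2 _ (intervalHom b d c e ⟨h₁, h₂, h₃⟩ 1)
      (intervalHom c e b' d' ⟨h₄, by omega, h₅⟩ (coeff x)) (interval_hom_ext hbd (by
        refine coeff_injective ?_
        rw [← hx, comp_app, LinearMap.comp_apply, coeff_intervalHom_app _ _ h₁ hle.2.1,
          coeff_intervalHom_app _ _ le_rfl h₂, coeff_intervalVec, one_mul, one_mul]))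
      with ⟨⟨r, hr⟩⟩ | ⟨⟨r, hr⟩⟩
    -- If the second factor is a retraction, then `(c,e) = (b',d')`; if the first is a section, then
    -- `(c,e) = (b,d)`, against `h₆`.
    · have := eq_of_comp_eq_id hbd' (by omega) _ _ hr
      omega
    · have := eq_of_comp_eq_id hbd (by omega) _ _ hr
      omega
  have hb2 := b'.2
  have hbn := b.2
  by_cases hb : b'.1 = b.1
  · by_cases hd : d'.1 = d.1
    · obtain rfl : b' = b := LinearA.ext hb
      obtain rfl : d' = d := LinearA.ext hd
      -- A nonzero endomorphism of an interval is a nonzero scalar, hence a section.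
      refine absurd (isSplitMono_of_functional hbd f ((coeff x)⁻¹ • coeffLinear K _ _ d') ?_ ?_)
        hf.1.1
      · intro i hi z
        rw [interval_eq_zero (fun h => absurd h.1 (not_le.2 hi)) z, map_zero, map_zero]
      · rw [LinearMap.smul_apply, coeffLinear_apply, coeff_transition hbd le_rfl le_rfl, ← hx,
          smul_eq_mul, inv_mul_cancel₀ fun h => hne (coeff_injective h)]
    · have hd2 := d.2
      -- Now `d' < d`, so `I[b,d-1]` lies in between and must be the target.
      have := factor b ⟨d.1 - 1, by omega⟩ le_rfl (by change b.1 ≤ d.1 - 1; omega)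
        (by change d.1 - 1 ≤ d.1; omega) (by omega) (by change d'.1 ≤ d.1 - 1; omega)
        (by right; change d.1 - 1 ≠ d.1; omega)
      have h2 : d.1 - 1 = d'.1 := this.2
      omega
  -- Now `b' < b`, so `I[b-1,d]` lies in between and must be the target.
  · have := factor ⟨b.1 - 1, by omega⟩ d (by change b.1 - 1 ≤ b.1; omega) hbd le_rfl
      (by change b'.1 ≤ b.1 - 1; omega) hle.2.2 (by left; change b.1 - 1 ≠ b.1; omega)
    have h2 : b.1 - 1 = b'.1 := this.1
    omega

end Interval

end QuiverRep

/-! ### The grid as vertex set -/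

namespace PDGrid

variable {n : ℕ}

/-- The birth of a grid point, as a vertex. -/
def birth (p : PDGrid n) : LinearA n := ⟨p.1.1, p.2.1, p.2.2.1.trans p.2.2.2⟩

/-- The death of a grid point, as a vertex. -/
def death (p : PDGrid n) : LinearA n := ⟨p.1.2, p.2.1.trans p.2.2.1, p.2.2.2⟩

theorem birth_le_death (p : PDGrid n) : p.birth.1 ≤ p.death.1 := p.2.2.1

/-- The vertex of the Auslander–Reiten quiver given by a grid point. -/
noncomputable def toARQuiver (K : Type u) [Field K] (p : PDGrid n) : ARQuiver K (LinearA n) :=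
  ⟨(intervalRep K n p.birth.1 p.death.1).isoClass, _, rfl,
    QuiverRep.interval_isIndecomposable p.birth_le_death⟩

theorem toARQuiver_bijective (K : Type u) [Field K] :
    Function.Bijective (toARQuiver K : PDGrid n → ARQuiver K (LinearA n)) := by
  constructor
  · intro p q hpq
    obtain ⟨i⟩ := QuiverRep.isoClass_eq_iff.1 (congrArg Subtype.val hpq)
    have h := QuiverRep.eq_of_comp_eq_id p.birth_le_death q.birth_le_death i.hom i.inv
      i.hom_inv_id
    exact Subtype.ext (Prod.ext h.1 h.2)
  · rintro ⟨c, M, rfl, hM⟩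
    obtain ⟨b, d, hbd, f, g, hfg⟩ := QuiverRep.exists_interval_summand hM.1
    refine ⟨⟨(b.1, d.1), b.2.1, hbd, d.2.2⟩, Subtype.ext ?_⟩
    exact QuiverRep.isoClass_eq_iff.2
      (hM.nonempty_iso hfg ⟨b, QuiverRep.interval_nontrivial hbd⟩)

end PDGrid

theorem theorem3p3 (K : Type u) [Field K] (n : ℕ) :
    ∃ e : PDGrid n ≃ ARQuiver K (LinearA n),
      (∀ p : PDGrid n, (e p).1 = (intervalRep K n p.1.1 p.1.2).isoClass) ∧
      ∀ p q : PDGrid n, Nonempty (e p ⟶ e q) ↔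
        (q.1.1 + 1 = p.1.1 ∧ q.1.2 = p.1.2) ∨ (q.1.1 = p.1.1 ∧ q.1.2 + 1 = p.1.2) := by
  refine ⟨Equiv.ofBijective _ (PDGrid.toARQuiver_bijective K), fun p => rfl, fun p q => ⟨?_, ?_⟩⟩
  · rintro ⟨⟨M, N, f, hM, hN, hf⟩⟩
    obtain ⟨s⟩ := QuiverRep.isoClass_eq_iff.1 hM
    obtain ⟨t⟩ := QuiverRep.isoClass_eq_iff.1 hN
    exact QuiverRep.eq_of_isIrreducible p.birth_le_death q.birth_le_death
      (hf.iso_comp_iso s.symm t)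
  · rintro (⟨hb, hd⟩ | ⟨hb, hd⟩)
    · have hd' : q.death = p.death := LinearA.ext hd
      refine ⟨⟨_, _, _, rfl, ?_, QuiverRep.isIrreducible_inclusion (b := p.birth) (d := p.death)
        (b' := q.birth) p.birth_le_death hb⟩⟩
      rw [← hd']
      rfl
    · have hb' : q.birth = p.birth := LinearA.ext hb
      refine ⟨⟨_, _, _, rfl, ?_, QuiverRep.isIrreducible_projection (b := p.birth) (d := p.death)
        (d' := q.death) (hb' ▸ q.birth_le_death) hd⟩⟩
      rw [← hb']
      rfl
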